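/- Let $n\ge 0$ and let $\mathbb{P}(n)$ be the manifold of positive definite Hermitian $n\times n$ complex matrices, an open subset of the real vector space $\mathbb{H}(n)$ of Hermitian matrices, with which every tangent space of $\mathbb{P}(n)$ is identified. For $\Sigma\in\mathbb{P}(n)$ and $H\in\mathbb{H}(n)$ let $\mathcal{L}_\Sigma(H)$ denote the unique solution $X\in\mathbb{H}(n)$ of $\Sigma X+X\Sigma=H$, and equip $\mathbb{P}(n)$ with the Bures-Wasserstein Riemannian metric $$\mathfrak{g}^{BW}_\Sigma(H,K)=\tfrac12\,\mathrm{Re}\,\mathrm{tr}\big(\mathcal{L}_\Sigma(H)K\big),\qquad H,K\in\mathbb{H}(n).$$ Let $\pi(M)=MM^*$ for complex $n\times n$ matrices $M$; at an invertible $M$, call a matrix $A$ horizontal if $\mathrm{Re}\,\mathrm{tr}(AB^*)=0$ for all $B\in\ker d\pi_M$. Let $\Sigma_1,\Sigma_2\in\mathbb{P}(n)$, let $U=(MM^*)^{-1/2}M$ be the unitary polar factor of $M=\Sigma_2^{1/2}\Sigma_1^{1/2}$, and put $$\gamma(t)=(1-t)\,\Sigma_1^{1/2}+t\,\Sigma_2^{1/2}U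 .$$ Then $\gamma(t)$ is invertible for every $t\in[0,1]$, the vector $\gamma'(0)$ is horizontal at $\gamma(0)$, and $\pi\circ\gamma:[0,1]\to\mathbb{P}(n)$ is a geodesic of $(\mathbb{P}(n),\mathfrak{g}^{BW})$ from $\Sigma_1$ to $\Sigma_2$; that is, $\pi\circ\gamma$ is a smooth curve in $\mathbb{P}(n)$ with $\pi(\gamma(0))=\Sigma_1$, $\pi(\gamma(1))=\Sigma_2$, and its velocity is parallel along it for the Levi-Civita connection of $\mathfrak{g}^{BW}$. -/

import Mathlib

open Set
open scoped ContDiff Matrix ComplexOrder MatrixOrder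

/-! ### Riemannian metrics and geodesics on open subsets of a vector space -/

section Riemannian

variable {E : Type*} [NormedAddCommGroup E] [NormedSpace ℝ E] [FiniteDimensional ℝ E]

/-- A smooth Riemannian metric on an open subset `Ω` of a finite dimensional real vector space `E`.
Every tangent space of `Ω` is identified with `E`.  (The values of `inner` outside `Ω` are
irrelevant.) -/
structure RiemannianMetricOn (Ω : TopologicalSpace.Opens E) where
  inner : E → E →ₗ[ℝ] E →ₗ[ℝ] ℝ
  symm : ∀ p ∈ Ω, ∀ v w, inner p v w = inner p w v
  pos : ∀ p ∈ Ω, ∀ v, v ≠ 0 → 0 < inner p v v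
  smooth : ∀ v w, ContDiffOn ℝ ∞ (fun p => inner p v w) Ω

variable {Ω : TopologicalSpace.Opens E}

/-- The Christoffel symbols of the first kind of the Levi-Civita connection in the linear
coordinates of `E`: for constant vector fields `u`, `v`, `w` this is `g(∇_u v, w)`, given by the
Koszul formula `½ (∂_u g(v,w) + ∂_v g(u,w) - ∂_w g(u,v))`. -/
noncomputable def RiemannianMetricOn.christoffel (g : RiemannianMetricOn Ω) (p u v w : E) : ℝ :=
  (1 / 2) * (fderiv ℝ (fun q => g.inner q v w) p u + fderiv ℝ (fun q => g.inner q u w) p v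
    - fderiv ℝ (fun q => g.inner q u v) p w)

/-- `c` restricted to the interval `I` is a geodesic of `(Ω, g)`: it is a smooth curve in `Ω` and
its velocity is parallel along it, `∇_{c'} c' = 0`.  As `g` is nondegenerate, the latter is tested
against all tangent vectors `w`: `g(c'', w) + g(Γ(c', c'), w) = 0`. -/
structure RiemannianMetricOn.IsGeodesicOn (g : RiemannianMetricOn Ω) (c : ℝ → E) (I : Set ℝ) :
    Prop where
  smooth : ContDiffOn ℝ ∞ c I
  mem : ∀ t ∈ I, c t ∈ Ω
  equation : ∀ t ∈ I, ∀ w : E,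
    g.inner (c t) (derivWithin (derivWithin c I) I t) w
      + g.christoffel (c t) (derivWithin c I t) (derivWithin c I t) w = 0

/-- `c : [0,1] → Ω` is a geodesic of `(Ω, g)` from `p` to `q`. -/
def RiemannianMetricOn.IsGeodesicFromTo (g : RiemannianMetricOn Ω) (c : ℝ → E) (p q : E) : Prop :=
  g.IsGeodesicOn c (Icc 0 1) ∧ c 0 = p ∧ c 1 = q

end Riemannian

/-! ### Matrices -/

/-- Complex `n × n` matrices. -/
abbrev CMat (n : ℕ) : Type := Matrix (Fin n) (Fin n) ℂ

/-! Matrices carry the Frobenius (Euclidean) norm. -/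

attribute [local instance] Matrix.frobeniusNormedAddCommGroup Matrix.frobeniusNormedSpace

/-- The real vector space `ℍ(n)` of Hermitian matrices, with the Frobenius norm. -/
def HermMat (n : ℕ) : Type := ↥(selfAdjoint.submodule ℝ (CMat n))

noncomputable instance HermMat.instNormedAddCommGroup (n : ℕ) : NormedAddCommGroup (HermMat n) :=
  inferInstanceAs (NormedAddCommGroup ↥(selfAdjoint.submodule ℝ (CMat n)))

noncomputable instance HermMat.instNormedSpace (n : ℕ) : NormedSpace ℝ (HermMat n) :=
  inferInstanceAs (NormedSpace ℝ ↥(selfAdjoint.submodule ℝ (CMat n)))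

instance HermMat.instFiniteDimensional (n : ℕ) : FiniteDimensional ℝ (HermMat n) :=
  inferInstanceAs (FiniteDimensional ℝ ↥(selfAdjoint.submodule ℝ (CMat n)))

/-- The inclusion of the Hermitian matrices into all matrices. -/
noncomputable def HermMat.toMat {n : ℕ} : HermMat n →ₗ[ℝ] CMat n :=
  (selfAdjoint.submodule ℝ (CMat n)).subtype

noncomputable instance HermMat.instCoe (n : ℕ) : CoeOut (HermMat n) (CMat n) := ⟨HermMat.toMat⟩

/-- A Hermitian matrix as an element of `ℍ(n)`. -/
def HermMat.mk {n : ℕ} (A : CMat n) (hA : A.IsHermitian) : HermMat n := ⟨A, hA⟩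

@[simp] theorem HermMat.toMat_mk {n : ℕ} (A : CMat n) (hA : A.IsHermitian) :
    ((HermMat.mk A hA : HermMat n) : CMat n) = A := rfl

theorem HermMat.toMat_injective {n : ℕ} : Function.Injective (HermMat.toMat (n := n)) :=
  Subtype.val_injective

@[ext] theorem HermMat.ext {n : ℕ} {X Y : HermMat n} (h : (X : CMat n) = Y) : X = Y :=
  HermMat.toMat_injective h

theorem HermMat.conjTranspose_eq {n : ℕ} (X : HermMat n) : (X : CMat n)ᴴ = X := X.2

theorem HermMat.continuous_toMat {n : ℕ} : Continuous (HermMat.toMat (n := n)) :=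
  LinearMap.continuous_of_finiteDimensional _

/-- The positive semidefinite square root of a positive semidefinite matrix. -/
noncomputable def matSqrt {n : ℕ} (A : CMat n) : CMat n := CFC.sqrt A

/-- The unitary polar factor `U = (M M*)^{-1/2} M` of an invertible matrix `M`, so that
`M = (M M*)^{1/2} U`. -/
noncomputable def polarFactor {n : ℕ} (M : CMat n) : CMat n := (matSqrt (M * Mᴴ))⁻¹ * M

theorem isOpen_posDef (n : ℕ) : IsOpen {S : HermMat n | (S : CMat n).PosDef} := by
  have key : {S : HermMat n | (S : CMat n).PosDef}
      = {S : HermMat n | ∀ x ∈ Metric.sphere (0 : EuclideanSpace ℂ (Fin n)) 1,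
          0 < (star (WithLp.ofLp x) ⬝ᵥ ((S : CMat n) *ᵥ (WithLp.ofLp x))).re} := by
    ext S
    constructor
    · intro hS x hx
      refine hS.re_dotProduct_pos (x := WithLp.ofLp x) ?_
      intro h
      have : x = 0 := by ext i; exact congrFun h i
      simp [this] at hx
    · intro h
      have hH : (S : CMat n).IsHermitian := S.2
      refine Matrix.PosDef.of_dotProduct_mulVec_pos hH fun x hx => ?_
      have hx' : (WithLp.toLp 2 x : EuclideanSpace ℂ (Fin n)) ≠ 0 := by
        intro h0; apply hx; simpa using h0
      have hn : (‖(WithLp.toLp 2 x : EuclideanSpace ℂ (Fin n))‖ : ℝ) ≠ 0 := by simpa using hx'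
      set r : ℝ := ‖(WithLp.toLp 2 x : EuclideanSpace ℂ (Fin n))‖
      have h1 := h ((r : ℂ)⁻¹ • WithLp.toLp 2 x) (by
        have hr : 0 ≤ r := norm_nonneg _
        simp only [mem_sphere_iff_norm, sub_zero, norm_smul, norm_inv, Complex.norm_real,
          Real.norm_eq_abs, abs_of_nonneg hr]
        exact inv_mul_cancel₀ hn)
      have hre : 0 < (star x ⬝ᵥ ((S : CMat n) *ᵥ x)).re := by
        simp only [WithLp.ofLp_smul, star_smul, Matrix.mulVec_smul, smul_dotProduct,
          dotProduct_smul, smul_eq_mul] at h1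
        rw [← Complex.ofReal_inv, RCLike.star_def, Complex.conj_ofReal, Complex.re_ofReal_mul,
          Complex.re_ofReal_mul, ← mul_assoc] at h1
        exact pos_of_mul_pos_right h1 (mul_self_nonneg _)
      rw [Complex.lt_def]
      refine ⟨hre, ?_⟩
      have := hH.im_star_dotProduct_mulVec_self x
      simpa using this.symm
  rw [key, isOpen_iff_mem_nhds]
  intro S hS
  refine (isCompact_sphere _ _).eventually_forall_of_forall_eventually fun x hx => ?_
  have hc : Continuous fun z : HermMat n × EuclideanSpace ℂ (Fin n) =>
      (star (WithLp.ofLp z.2) ⬝ᵥ ((z.1 : CMat n) *ᵥ (WithLp.ofLp z.2))).re := by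
    have h2 : Continuous fun z : HermMat n × EuclideanSpace ℂ (Fin n) => WithLp.ofLp z.2 := by
      fun_prop
    have h3 : Continuous fun z : HermMat n × EuclideanSpace ℂ (Fin n) => (z.1 : CMat n) :=
      HermMat.continuous_toMat.comp continuous_fst
    exact Complex.continuous_re.comp (h2.star.dotProduct (h3.matrix_mulVec h2))
  exact hc.continuousAt.eventually (lt_mem_nhds (hS x hx))

/-- `ℙ(n)`: the positive definite matrices, as an open subset of the Hermitian matrices. -/
def posDefOpens (n : ℕ) : TopologicalSpace.Opens (HermMat n) :=
  ⟨{S | (S : CMat n).PosDef}, isOpen_posDef n⟩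

/-! ### The Bures-Wasserstein metric -/

/-- The Lyapunov map `X ↦ Σ X + X Σ` on Hermitian matrices, as a bilinear map in `(Σ, X)`. -/
noncomputable def lyapunovMap (n : ℕ) : HermMat n →ₗ[ℝ] HermMat n →ₗ[ℝ] HermMat n :=
  LinearMap.mk₂ ℝ
    (fun S X => HermMat.mk ((S : CMat n) * X + X * S) (by
      rw [Matrix.IsHermitian, Matrix.conjTranspose_add, Matrix.conjTranspose_mul, Matrix.conjTranspose_mul,
        S.conjTranspose_eq, X.conjTranspose_eq, add_comm]))
    (fun S T X => by ext1; simp only [HermMat.toMat_mk, map_add]; noncomm_ring)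
    (fun r S X => by ext1; simp)
    (fun S X Y => by ext1; simp only [HermMat.toMat_mk, map_add]; noncomm_ring)
    (fun r S X => by ext1; simp)

/-- The linear map `ℒ_Σ`, the inverse of `X ↦ Σ X + X Σ`; so `ℒ_Σ(H)` is the unique Hermitian
solution `X` of `Σ X + X Σ = H`, see `eq_lyapunovSol_iff`. -/
noncomputable def lyapunovSol {n : ℕ} (S : HermMat n) : HermMat n →L[ℝ] HermMat n :=
  (LinearMap.toContinuousLinearMap (lyapunovMap n S)).inverse

theorem re_trace_mul_mul_pos {n : ℕ} {S X : HermMat n} (hS : (S : CMat n).PosDef) (hX : X ≠ 0) :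
    0 < ((X : CMat n) * S * X).trace.re := by
  have h := hS.posSemidef.conjTranspose_mul_mul_same (X : CMat n)
  rw [X.conjTranspose_eq] at h
  have h0 := (Complex.le_def.1 h.trace_nonneg).1
  have h0' := (Complex.le_def.1 h.trace_nonneg).2
  refine lt_of_le_of_ne h0 fun h1 => hX ?_
  have h2 : (X : CMat n) * S * X = 0 := by
    rw [← h.trace_eq_zero_iff]
    exact Complex.ext h1.symm h0'.symm
  ext1
  refine Matrix.ext_of_mulVec_single fun i => ?_
  by_contra hne
  have hne' : (X : CMat n) *ᵥ Pi.single i 1 ≠ 0 := fun h0 =>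
    hne (by rw [h0, map_zero, Matrix.zero_mulVec])
  have h3 := hS.dotProduct_mulVec_pos hne'
  have h4 : star ((X : CMat n) *ᵥ Pi.single i 1) ⬝ᵥ ((S : CMat n) *ᵥ ((X : CMat n) *ᵥ Pi.single i 1))
      = star (Pi.single i 1 : Fin n → ℂ) ⬝ᵥ (((X : CMat n) * (S : CMat n) * (X : CMat n)) *ᵥ Pi.single i 1) := by
    rw [Matrix.star_mulVec, X.conjTranspose_eq, ← Matrix.dotProduct_mulVec, Matrix.mulVec_mulVec,
      Matrix.mulVec_mulVec, Matrix.mul_assoc]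
  rw [h4, h2, Matrix.zero_mulVec, dotProduct_zero] at h3
  exact lt_irrefl _ h3

theorem lyapunovMap_isInvertible {n : ℕ} {S : HermMat n} (hS : (S : CMat n).PosDef) :
    (LinearMap.toContinuousLinearMap (lyapunovMap n S)).IsInvertible := by
  have hinj : Function.Injective (lyapunovMap n S) := by
    rw [injective_iff_map_eq_zero]
    intro X hX
    by_contra hne
    have h1 := re_trace_mul_mul_pos hS hne
    have h2 : (S : CMat n) * X + X * S = 0 := congrArg HermMat.toMat hX
    have h3 : ((X : CMat n) * ((S : CMat n) * X + X * S)).trace.re = 0 := by rw [h2]; simp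
    rw [mul_add, Matrix.trace_add, Matrix.trace_mul_comm (X : CMat n) (X * S), Complex.add_re,
      ← mul_assoc] at h3
    linarith
  refine ⟨(LinearEquiv.ofInjectiveEndo _ hinj).toContinuousLinearEquiv, ?_⟩
  ext X : 1
  rfl

/-- For positive definite `Σ`, `ℒ_Σ(H)` is the unique solution of the Lyapunov equation. -/
theorem eq_lyapunovSol_iff {n : ℕ} {S : HermMat n} (hS : (S : CMat n).PosDef) (H X : HermMat n) :
    X = lyapunovSol S H ↔ (S : CMat n) * X + X * S = H := by
  obtain ⟨e, he⟩ := lyapunovMap_isInvertible hS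
  rw [lyapunovSol, ← he, ContinuousLinearMap.inverse_equiv]
  have h : (S : CMat n) * X + X * S = (e X : HermMat n) := by
    have := congrArg (fun f : HermMat n →L[ℝ] HermMat n => ((f X : HermMat n) : CMat n)) he
    exact this.symm
  rw [h, HermMat.toMat_injective.eq_iff]
  exact (ContinuousLinearEquiv.eq_symm_apply e)

theorem lyapunovSol_spec {n : ℕ} {S : HermMat n} (hS : (S : CMat n).PosDef) (H : HermMat n) :
    (S : CMat n) * lyapunovSol S H + lyapunovSol S H * S = H :=
  (eq_lyapunovSol_iff hS H _).1 rfl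

/-- The real bilinear form `(H, K) ↦ ½ Re tr(ℒ_Σ(H) K)` on Hermitian matrices. -/
noncomputable def bwInner {n : ℕ} (S : HermMat n) : HermMat n →ₗ[ℝ] HermMat n →ₗ[ℝ] ℝ :=
  LinearMap.mk₂ ℝ (fun H K => (1 / 2) * ((lyapunovSol S H : CMat n) * K).trace.re)
    (fun H H' K => by simp [add_mul]; ring)
    (fun r H K => by simp; ring)
    (fun H K K' => by simp [mul_add])
    (fun r H K => by simp; ring)

/-- The Bures-Wasserstein metric `g_Σ(H, K) = ½ Re tr(ℒ_Σ(H) K)` on `ℙ(n)`. -/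
noncomputable def bwMetric (n : ℕ) : RiemannianMetricOn (posDefOpens n) where
  inner := bwInner
  symm S hS H K := by
    change (1 / 2) * ((lyapunovSol S H : CMat n) * K).trace.re
      = (1 / 2) * ((lyapunovSol S K : CMat n) * H).trace.re
    have hH := lyapunovSol_spec hS H
    have hK := lyapunovSol_spec hS K
    generalize lyapunovSol S H = X at *
    generalize lyapunovSol S K = Y at *
    rw [← hH, ← hK, mul_add, mul_add, Matrix.trace_add, Matrix.trace_add]
    have e1 : ((X : CMat n) * (S * Y)).trace = ((Y : CMat n) * (X * S)).trace := by
      rw [← mul_assoc, Matrix.trace_mul_comm]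
    have e2 : ((X : CMat n) * (Y * S)).trace = ((Y : CMat n) * (S * X)).trace := by
      rw [Matrix.trace_mul_comm, mul_assoc]
    rw [e1, e2, add_comm]
  pos S hS H hH := by
    change 0 < (1 / 2) * ((lyapunovSol S H : CMat n) * H).trace.re
    have h := lyapunovSol_spec hS H
    generalize lyapunovSol S H = X at *
    have hX : X ≠ 0 := by
      rintro rfl
      apply hH
      ext1
      rw [← h]
      simp
    have := re_trace_mul_mul_pos hS hX
    rw [← h, mul_add, Matrix.trace_add, Matrix.trace_mul_comm (X : CMat n) (X * S), Complex.add_re,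
      ← mul_assoc]
    linarith
  smooth H K := by
    have h1 : ContDiffOn ℝ ∞ (fun S : HermMat n => lyapunovSol S H) (posDefOpens n) := by
      intro S hS
      obtain ⟨e, he⟩ := lyapunovMap_isInvertible (S := S) hS
      have h2 : ContDiffAt ℝ ∞ ContinuousLinearMap.inverse
          (LinearMap.toContinuousLinearMap (lyapunovMap n S)) := by
        rw [← he]; exact contDiffAt_map_inverse e
      have h3 : ContDiff ℝ ∞ fun S : HermMat n =>
          LinearMap.toContinuousLinearMap (lyapunovMap n S) :=
        (LinearMap.toContinuousLinearMap
          ((LinearMap.toContinuousLinearMap (E := HermMat n) (F' := HermMat n)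
            (𝕜 := ℝ)).toLinearMap ∘ₗ lyapunovMap n)).contDiff
      have h4 : ContDiffAt ℝ ∞ (fun S : HermMat n => lyapunovSol S) S :=
        ContDiffAt.comp S h2 h3.contDiffAt
      exact (h4.clm_apply contDiffAt_const).contDiffWithinAt
    have h5 : ContDiff ℝ ∞ fun X : HermMat n => (1 / 2) * ((X : CMat n) * K).trace.re := by
      let ℓ : HermMat n →ₗ[ℝ] ℝ :=
        { toFun := fun X => (1 / 2) * ((X : CMat n) * K).trace.re
          map_add' := fun X Y => by simp [add_mul]; ring
          map_smul' := fun r X => by simp; ring }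
      exact (LinearMap.toContinuousLinearMap ℓ).contDiff
    exact h5.comp_contDiffOn h1

/-! ### The map `π : M ↦ M M*` and its horizontal spaces -/

/-- The map `π(M) = M M*`. -/
def gramMap {n : ℕ} (M : CMat n) : HermMat n :=
  HermMat.mk (M * Mᴴ) (Matrix.isHermitian_mul_conjTranspose_self M)

/-- The vertical space `ker dπ_M` of `π` at `M`. -/
noncomputable def verticalSpace {n : ℕ} (M : CMat n) : Submodule ℝ (CMat n) :=
  LinearMap.ker (fderiv ℝ (gramMap (n := n)) M).toLinearMap

/-- The horizontal space of `π` at `M`: the orthogonal complement of the vertical space for the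
Euclidean metric `Re tr(A B*)`. -/
def horizontalSpace {n : ℕ} (M : CMat n) : Set (CMat n) :=
  {A | ∀ B ∈ verticalSpace M, (A * Bᴴ).trace.re = 0}

/-! ### Square roots and the polar factor -/

/-! Write A and B for the square roots of Σ₁ and Σ₂. The transport matrix T of
`exists_posDef_mul_eq_mul_polarFactor` is positive definite and satisfies T A = B U, so γ(t) = N A
with N = 1 + t K and K = T - 1. Since N is a convex combination of 1 and T, it is positive definite
on [0,1], which makes γ(t) invertible. The velocity γ'(0) = K A is a Hermitian matrix times γ(0),
hence horizontal (`mul_mem_horizontalSpace`).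

The projected curve is S = N Σ₁ N. The geodesic equation is checked directly, without submersion
theory. With X = K N⁻¹ the velocity is S X + X S and the acceleration is 2 X S X. Differentiating
the Lyapunov equation gives the derivative of the metric (`fderiv_lyapunovSol`, `fderiv_bwInner`),
and `bwMetric_geodesic_equation` shows that 2 X S X is exactly the acceleration which the
Christoffel term demands. -/

theorem matSqrt_mul_self {n : ℕ} {A : CMat n} (hA : A.PosDef) : matSqrt A * matSqrt A = A :=
  CFC.sqrt_mul_sqrt_self A hA.posSemidef.nonneg

theorem posDef_matSqrt {n : ℕ} {A : CMat n} (hA : A.PosDef) : (matSqrt A).PosDef := by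
  have h : (matSqrt A).PosSemidef := Matrix.nonneg_iff_posSemidef.1 (CFC.sqrt_nonneg A)
  refine h.posDef_iff_isUnit.2 ?_
  have h2 : IsUnit (matSqrt A * matSqrt A) := by rw [matSqrt_mul_self hA]; exact hA.isUnit
  rw [Matrix.isUnit_iff_isUnit_det, Matrix.det_mul] at h2
  exact (Matrix.isUnit_iff_isUnit_det _).2 (isUnit_of_mul_isUnit_left h2)

theorem posDef_mul_conjTranspose {n : ℕ} {M : CMat n} (hM : IsUnit M) : (M * Mᴴ).PosDef :=
  (Matrix.posSemidef_self_mul_conjTranspose M).posDef_iff_isUnit.2 (hM.mul hM.star)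

/-- With R the square root of M M*, the product is R⁻¹ (M M*) R⁻¹ = R⁻¹ R² R⁻¹. -/
theorem polarFactor_mul_conjTranspose {n : ℕ} {M : CMat n} (hM : IsUnit M) :
    polarFactor M * (polarFactor M)ᴴ = 1 := by
  have hP := posDef_mul_conjTranspose hM
  have hR := posDef_matSqrt hP
  have hdet := (Matrix.isUnit_iff_isUnit_det _).1 hR.isUnit
  rw [polarFactor, Matrix.conjTranspose_mul, Matrix.conjTranspose_nonsing_inv,
    hR.isHermitian.eq, mul_assoc, ← mul_assoc M]
  nth_rewrite 2 [← matSqrt_mul_self hP]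
  rw [mul_assoc, Matrix.mul_nonsing_inv _ hdet, mul_one, Matrix.nonsing_inv_mul _ hdet]

/-- The transport matrix `T = B U A⁻¹` from `A²` to `B²`, where `U` is the polar factor of `B A`,
is positive definite. -/
theorem exists_posDef_mul_eq_mul_polarFactor {n : ℕ} {A B : CMat n} (hA : A.PosDef)
    (hB : B.PosDef) : ∃ T : CMat n, T.PosDef ∧ T * A = B * polarFactor (B * A) := by
  have hM : IsUnit (B * A) := hB.isUnit.mul hA.isUnit
  have hR := (posDef_matSqrt (posDef_mul_conjTranspose hM)).inv
  -- Since U = R⁻¹ B A with R the square root in the formula, B U A⁻¹ = B R⁻¹ B. This is a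
  -- congruence of the positive definite R⁻¹ by the Hermitian B.
  refine ⟨B * (matSqrt (B * A * (B * A)ᴴ))⁻¹ * B, ?_, ?_⟩
  · have h := hR.posSemidef.mul_mul_conjTranspose_same B
    rw [hB.isHermitian.eq] at h
    exact h.posDef_iff_isUnit.2 ((hB.isUnit.mul hR.isUnit).mul hB.isUnit)
  · rw [polarFactor]
    simp only [mul_assoc]

theorem posDef_one_add_smul_sub_one {n : ℕ} {T : CMat n} (hT : T.PosDef) {t : ℝ}
    (ht : t ∈ Icc (0 : ℝ) 1) : (1 + t • (T - 1)).PosDef := by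
  have h : 1 + t • (T - 1) = (1 - t) • (1 : CMat n) + t • T := by module
  rw [h]
  -- For t > 0 the summand t T is positive definite and the other only semidefinite (it vanishes at
  -- t = 1); at t = 0 the roles are exchanged.
  rcases ht.1.eq_or_lt with rfl | h0
  · simpa using Matrix.PosDef.one
  · exact Matrix.PosDef.posSemidef_add (Matrix.PosSemidef.one.smul (sub_nonneg.2 ht.2)) (hT.smul h0)

/-! ### The derivative of the Bures-Wasserstein metric -/

@[simp] theorem toMat_lyapunovMap {n : ℕ} (S X : HermMat n) :
    ((lyapunovMap n S X : HermMat n) : CMat n) = (S : CMat n) * X + X * S := rfl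

theorem bwInner_apply {n : ℕ} (S H K : HermMat n) :
    bwInner S H K = (1 / 2) * ((lyapunovSol S H : CMat n) * K).trace.re := rfl

theorem lyapunovSol_lyapunovMap {n : ℕ} {S : HermMat n} (hS : (S : CMat n).PosDef)
    (X : HermMat n) : lyapunovSol S (lyapunovMap n S X) = X :=
  ((eq_lyapunovSol_iff hS _ _).2 rfl).symm

theorem lyapunovMap_lyapunovSol {n : ℕ} {S : HermMat n} (hS : (S : CMat n).PosDef)
    (H : HermMat n) : lyapunovMap n S (lyapunovSol S H) = H :=
  HermMat.ext (lyapunovSol_spec hS H)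

/-- The Lyapunov map as a continuous bilinear map. -/
noncomputable def lyapunovCLM (n : ℕ) : HermMat n →L[ℝ] HermMat n →L[ℝ] HermMat n :=
  LinearMap.toContinuousLinearMap
    ((LinearMap.toContinuousLinearMap (E := HermMat n) (F' := HermMat n)
      (𝕜 := ℝ)).toLinearMap ∘ₗ lyapunovMap n)

@[simp] theorem lyapunovCLM_apply {n : ℕ} (S X : HermMat n) :
    lyapunovCLM n S X = lyapunovMap n S X := rfl

theorem differentiableAt_lyapunovSol {n : ℕ} {S : HermMat n} (hS : (S : CMat n).PosDef)
    (H : HermMat n) : DifferentiableAt ℝ (fun S => lyapunovSol S H) S := by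
  obtain ⟨e, he⟩ := lyapunovMap_isInvertible hS
  have h1 : DifferentiableAt ℝ ContinuousLinearMap.inverse (lyapunovCLM n S) := by
    change DifferentiableAt ℝ _ (LinearMap.toContinuousLinearMap (lyapunovMap n S))
    rw [← he]
    exact (contDiffAt_map_inverse (n := 1) e).differentiableAt one_ne_zero
  exact (h1.comp S (lyapunovCLM n).differentiableAt).clm_apply (differentiableAt_const H)

/-- Implicit differentiation: S ℒ_S(H) + ℒ_S(H) S = H is constant in S on the open set of positive
definite matrices, so the product rule gives a Lyapunov equation for the derivative. -/
theorem fderiv_lyapunovSol {n : ℕ} {S : HermMat n} (hS : (S : CMat n).PosDef) (H u : HermMat n) :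
    fderiv ℝ (fun S => lyapunovSol S H) S u
      = -lyapunovSol S (lyapunovMap n u (lyapunovSol S H)) := by
  have h1 := (lyapunovCLM n).hasFDerivAt (x := S) |>.clm_apply
    (differentiableAt_lyapunovSol hS H).hasFDerivAt
  have h2 : (fun S => lyapunovCLM n S (lyapunovSol S H)) =ᶠ[nhds S] fun _ => H := by
    filter_upwards [(isOpen_posDef n).mem_nhds hS] with T hT using lyapunovMap_lyapunovSol hT H
  have h3 := congrArg (fun f => f u)
    (h1.unique ((hasFDerivAt_const H S).congr_of_eventuallyEq h2))
  simp only [add_apply, ContinuousLinearMap.comp_apply,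
    ContinuousLinearMap.flip_apply, lyapunovCLM_apply, zero_apply] at h3
  have h4 := congrArg (lyapunovSol S) (eq_neg_of_add_eq_zero_left h3)
  rwa [lyapunovSol_lyapunovMap hS, map_neg] at h4

theorem fderiv_bwInner {n : ℕ} {S : HermMat n} (hS : (S : CMat n).PosDef) (u H K : HermMat n) :
    fderiv ℝ (fun S => bwInner S H K) S u
      = -bwInner S (lyapunovMap n u (lyapunovSol S H)) K := by
  let ℓ : HermMat n →ₗ[ℝ] ℝ :=
    { toFun := fun X => (1 / 2) * ((X : CMat n) * K).trace.re
      map_add' := fun X Y => by simp [add_mul]; ring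
      map_smul' := fun r X => by simp; ring }
  have h := (LinearMap.toContinuousLinearMap ℓ).hasFDerivAt.comp S
    (differentiableAt_lyapunovSol hS H).hasFDerivAt
  have h2 : fderiv ℝ (fun S => bwInner S H K) S u
      = ℓ (fderiv ℝ (fun S => lyapunovSol S H) S u) :=
    congrArg (fun f => f u) h.fderiv
  rw [h2, fderiv_lyapunovSol hS, map_neg]
  rfl

theorem bwInner_comm {n : ℕ} {S : HermMat n} (hS : (S : CMat n).PosDef) (H K : HermMat n) :
    bwInner S H K = bwInner S K H := (bwMetric n).symm S hS H K

/-- The geodesic equation of the Bures-Wasserstein metric, with the velocity `S X + X S` at `S`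
written in terms of its Lyapunov solution `X`. -/
theorem bwMetric_geodesic_equation {n : ℕ} {S : HermMat n} (hS : (S : CMat n).PosDef)
    {a X : HermMat n} (ha : (a : CMat n) = (2 : ℝ) • ((X : CMat n) * S * X)) (w : HermMat n) :
    (bwMetric n).inner S a w
      + (bwMetric n).christoffel S (lyapunovMap n S X) (lyapunovMap n S X) w = 0 := by
  have h1 : (bwMetric n).christoffel S (lyapunovMap n S X) (lyapunovMap n S X) w
      = (1 / 2) * (-bwInner S (lyapunovMap n (lyapunovMap n S X) X) w
        + -bwInner S (lyapunovMap n (lyapunovMap n S X) X) w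
        - -bwInner S (lyapunovMap n w X) (lyapunovMap n S X)) := by
    change (1 / 2) * (fderiv ℝ (fun S => bwInner S _ _) S _ + fderiv ℝ (fun S => bwInner S _ _) S _
      - fderiv ℝ (fun S => bwInner S _ _) S _) = _
    simp only [fderiv_bwInner hS, lyapunovSol_lyapunovMap hS]
  -- The matrix X² represents the last Christoffel term: by symmetry of the metric and cyclicity of
  -- the trace, ½ g(w X + X w, S X + X S) = ½ Re tr(X² w) = g(S X² + X² S, w). The equation then
  -- reduces to the identity `h2`.
  let Y : HermMat n := HermMat.mk ((X : CMat n) * X) (by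
    rw [Matrix.IsHermitian, Matrix.conjTranspose_mul, X.conjTranspose_eq])
  have h2 : a = lyapunovMap n (lyapunovMap n S X) X - lyapunovMap n S Y := by
    ext1
    simp only [map_sub, toMat_lyapunovMap, ha, Y, HermMat.toMat_mk, two_smul]
    noncomm_ring
  change bwInner S a w + _ = 0
  rw [h1, h2, bwInner_comm hS (lyapunovMap n w X), map_sub, LinearMap.sub_apply,
    bwInner_apply S (lyapunovMap n S Y), bwInner_apply S (lyapunovMap n S X),
    lyapunovSol_lyapunovMap hS, lyapunovSol_lyapunovMap hS, toMat_lyapunovMap, mul_add,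
    Matrix.trace_add, Matrix.trace_mul_comm (X : CMat n) (w * X), Complex.add_re, mul_assoc,
    Matrix.trace_mul_comm (w : CMat n), ← mul_assoc]
  simp only [Y, HermMat.toMat_mk]
  ring

/-! ### Curves of the form `t ↦ (1 + t K) S (1 + t K)` -/

/-- The congruence `K S K` of Hermitian matrices. -/
noncomputable def HermMat.conj {n : ℕ} (K S : HermMat n) : HermMat n :=
  HermMat.mk ((K : CMat n) * S * K) (by
    rw [Matrix.IsHermitian, Matrix.conjTranspose_mul, Matrix.conjTranspose_mul,
      S.conjTranspose_eq, K.conjTranspose_eq, mul_assoc])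

/-- `S + t (K S + S K) + t² K S K`, that is, `(1 + t K) S (1 + t K)`. -/
noncomputable def congrCurve {n : ℕ} (S K : HermMat n) (t : ℝ) : HermMat n :=
  S + t • lyapunovMap n S K + t ^ 2 • HermMat.conj K S

theorem toMat_congrCurve {n : ℕ} (S K : HermMat n) (t : ℝ) :
    (congrCurve S K t : CMat n) = (1 + t • (K : CMat n)) * S * (1 + t • (K : CMat n)) := by
  simp only [congrCurve, map_add, map_smul, toMat_lyapunovMap, HermMat.conj, HermMat.toMat_mk,
    mul_add, add_mul, one_mul, mul_one, smul_mul_assoc, mul_smul_comm, smul_smul, smul_add, pow_two]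
  abel

theorem hasDerivAt_congrCurve {n : ℕ} (S K : HermMat n) (t : ℝ) :
    HasDerivAt (congrCurve S K) (lyapunovMap n S K + (2 * t) • HermMat.conj K S) t := by
  have h1 := ((hasDerivAt_id t).smul_const (lyapunovMap n S K)).const_add S
  have h2 := (hasDerivAt_pow 2 t).smul_const (HermMat.conj K S)
  have h := h1.add h2
  simp only [one_smul, Nat.cast_ofNat, Nat.add_one_sub_one, pow_one] at h
  exact h

theorem contDiff_congrCurve {n : ℕ} (S K : HermMat n) : ContDiff ℝ ∞ (congrCurve S K) := by
  unfold congrCurve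
  fun_prop

/-- As long as `1 + t K` is positive definite, `t ↦ (1 + t K) S (1 + t K)` is a geodesic. -/
theorem isGeodesicOn_congrCurve {n : ℕ} {S : HermMat n} (hS : (S : CMat n).PosDef) (K : HermMat n)
    {I : Set ℝ} (hI : UniqueDiffOn ℝ I) (hK : ∀ t ∈ I, (1 + t • (K : CMat n)).PosDef) :
    (bwMetric n).IsGeodesicOn (congrCurve S K) I := by
  have hpos : ∀ t ∈ I, (congrCurve S K t : CMat n).PosDef := by
    intro t ht
    have h := hS.posSemidef.mul_mul_conjTranspose_same (1 + t • (K : CMat n))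
    rw [(hK t ht).isHermitian.eq] at h
    rw [toMat_congrCurve]
    exact h.posDef_iff_isUnit.2 (((hK t ht).isUnit.mul hS.isUnit).mul (hK t ht).isUnit)
  have hd : ∀ t ∈ I, derivWithin (congrCurve S K) I t
      = lyapunovMap n S K + (2 * t) • HermMat.conj K S := fun t ht =>
    (hasDerivAt_congrCurve S K t).hasDerivWithinAt.derivWithin (hI t ht)
  refine ⟨(contDiff_congrCurve S K).contDiffOn, hpos, fun t ht w => ?_⟩
  have hdd : derivWithin (derivWithin (congrCurve S K) I) I t = (2 : ℝ) • HermMat.conj K S := by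
    rw [derivWithin_congr hd (hd t ht)]
    have h := (((hasDerivAt_id t).const_mul 2).smul_const (HermMat.conj K S)).const_add
      (lyapunovMap n S K)
    rw [mul_one] at h
    exact h.hasDerivWithinAt.derivWithin (hI t ht)
  have hN := hK t ht
  have hdet := (Matrix.isUnit_iff_isUnit_det _).1 hN.isUnit
  set N : CMat n := 1 + t • (K : CMat n) with hNdef
  have hcomm : Commute (K : CMat n) N := (Commute.one_right _).add_right
    ((Commute.refl _).smul_right t)
  have hcomm' : (K : CMat n) * N⁻¹ = N⁻¹ * K := by
    calc (K : CMat n) * N⁻¹ = N⁻¹ * (N * K) * N⁻¹ := by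
          rw [← mul_assoc, Matrix.nonsing_inv_mul _ hdet, one_mul]
      _ = N⁻¹ * K := by
          rw [← hcomm.eq, mul_assoc, mul_assoc, Matrix.mul_nonsing_inv _ hdet, mul_one]
  -- The velocity is K S N + N S K and the point is N S N, so the Lyapunov solution should satisfy X
  -- N = N X = K. Both equations, and the Hermitian symmetry of X, hold because K commutes with N.
  -- They also turn the acceleration 2 K S K into 2 X (N S N) X.
  let X : HermMat n := HermMat.mk ((K : CMat n) * N⁻¹) (by
    rw [Matrix.IsHermitian, Matrix.conjTranspose_mul, Matrix.conjTranspose_nonsing_inv,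
      hN.isHermitian.eq, K.conjTranspose_eq, hcomm'])
  have hXl : (X : CMat n) * N = K := by
    simp only [X, HermMat.toMat_mk]
    rw [mul_assoc, Matrix.nonsing_inv_mul _ hdet, mul_one]
  have hXr : N * (X : CMat n) = K := by
    simp only [X, HermMat.toMat_mk]
    rw [hcomm', ← mul_assoc, Matrix.mul_nonsing_inv _ hdet, one_mul]
  have hc : (congrCurve S K t : CMat n) = N * S * N := toMat_congrCurve S K t
  have hv : lyapunovMap n S K + (2 * t) • HermMat.conj K S = lyapunovMap n (congrCurve S K t) X := by
    ext1
    rw [toMat_lyapunovMap, hc, mul_assoc _ N, hXr, ← mul_assoc (X : CMat n),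
      ← mul_assoc (X : CMat n), hXl, hNdef]
    simp only [map_add, map_smul, toMat_lyapunovMap, HermMat.conj, HermMat.toMat_mk,
      mul_add, add_mul, one_mul, mul_one, smul_mul_assoc, mul_smul_comm]
    module
  rw [hdd, hd t ht, hv]
  refine bwMetric_geodesic_equation (hpos t ht) ?_ w
  rw [map_smul, hc]
  congr 1
  calc ((HermMat.conj K S : HermMat n) : CMat n) = (X * N) * S * (N * X) := by
        rw [hXl, hXr]; rfl
    _ = _ := by simp only [mul_assoc]

/-! ### The vertical space of `π` -/

/-- The polarisation `A B* + B A*` of the Gram map, as a continuous bilinear map. -/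
noncomputable def gramPolar (n : ℕ) : CMat n →L[ℝ] CMat n →L[ℝ] HermMat n :=
  LinearMap.toContinuousLinearMap
    ((LinearMap.toContinuousLinearMap (E := CMat n) (F' := HermMat n) (𝕜 := ℝ)).toLinearMap ∘ₗ
      LinearMap.mk₂ ℝ (fun A B => HermMat.mk (A * Bᴴ + B * Aᴴ) (by
          simp [Matrix.IsHermitian, add_comm]))
        (fun A A' B => by
          ext1
          change (A + A') * Bᴴ + B * (A + A')ᴴ = (A * Bᴴ + B * Aᴴ) + (A' * Bᴴ + B * A'ᴴ)
          rw [Matrix.conjTranspose_add, add_mul, mul_add]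
          abel)
        (fun r A B => by
          ext1
          change (r • A) * Bᴴ + B * (r • A)ᴴ = r • (A * Bᴴ + B * Aᴴ)
          simp)
        (fun A B B' => by
          ext1
          change A * (B + B')ᴴ + (B + B') * Aᴴ = (A * Bᴴ + B * Aᴴ) + (A * B'ᴴ + B' * Aᴴ)
          rw [Matrix.conjTranspose_add, add_mul, mul_add]
          abel)
        (fun r A B => by
          ext1
          change A * (r • B)ᴴ + (r • B) * Aᴴ = r • (A * Bᴴ + B * Aᴴ)
          simp))

theorem toMat_gramPolar {n : ℕ} (A B : CMat n) :
    ((gramPolar n A B : HermMat n) : CMat n) = A * Bᴴ + B * Aᴴ := rfl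

/-- The Gram map is half of the symmetric form `gramPolar` on the diagonal; the two equal terms of
the product rule cancel the half. -/
theorem hasFDerivAt_gramMap {n : ℕ} (M : CMat n) :
    HasFDerivAt (gramMap (n := n)) (gramPolar n M) M := by
  have h := (((gramPolar n).hasFDerivAt (x := M)).clm_apply (hasFDerivAt_id M)).const_smul
    (1 / 2 : ℝ)
  have h1 : gramMap (n := n) = fun A => (1 / 2 : ℝ) • gramPolar n A A := by
    funext A
    ext1
    rw [map_smul, toMat_gramPolar]
    change A * Aᴴ = _
    module
  rw [h1]
  refine h.congr_fderiv ?_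
  ext B : 1
  ext1
  change (1 / 2 : ℝ) • ((M * Bᴴ + B * Mᴴ) + (B * Mᴴ + M * Bᴴ)) = M * Bᴴ + B * Mᴴ
  module

theorem mem_verticalSpace_iff {n : ℕ} {M B : CMat n} :
    B ∈ verticalSpace M ↔ M * Bᴴ + B * Mᴴ = 0 := by
  rw [verticalSpace, (hasFDerivAt_gramMap M).fderiv, LinearMap.mem_ker, ← toMat_gramPolar]
  exact (map_eq_zero_iff _ HermMat.toMat_injective).symm

/-- Matrices `K M` with `K` Hermitian are horizontal at `M`. -/
theorem mul_mem_horizontalSpace {n : ℕ} {K : CMat n} (hK : K.IsHermitian) (M : CMat n) :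
    K * M ∈ horizontalSpace M := by
  intro B hB
  -- Verticality says that M B* is skew-Hermitian, and the trace of a Hermitian times a
  -- skew-Hermitian matrix is purely imaginary.
  have h1 : B * Mᴴ = -(M * Bᴴ) := eq_neg_of_add_eq_zero_right (mem_verticalSpace_iff.1 hB)
  have h2 : (K * M * Bᴴ)ᴴ = -(M * Bᴴ * K) := by
    rw [mul_assoc, Matrix.conjTranspose_mul, Matrix.conjTranspose_mul,
      Matrix.conjTranspose_conjTranspose, hK.eq, h1, neg_mul]
  have h3 := congrArg Complex.re (congrArg Matrix.trace h2)
  rw [Matrix.trace_conjTranspose, Matrix.trace_neg, Matrix.trace_mul_comm _ K, ← mul_assoc,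
    Complex.star_def, Complex.conj_re, Complex.neg_re] at h3
  linarith

/-! ### The geodesic from Σ₁ to Σ₂ -/

theorem theorem2p9 (n : ℕ) (S₁ S₂ : HermMat n) (h₁ : S₁ ∈ posDefOpens n)
    (h₂ : S₂ ∈ posDefOpens n) (U : CMat n) (hU : U = polarFactor (matSqrt S₂ * matSqrt S₁))
    (γ : ℝ → CMat n)
    (hγ : ∀ t : ℝ, γ t = (1 - t) • matSqrt (S₁ : CMat n) + t • (matSqrt (S₂ : CMat n) * U)) :
    (∀ t ∈ Icc (0 : ℝ) 1, IsUnit (γ t)) ∧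
    deriv γ 0 ∈ horizontalSpace (γ 0) ∧
    (bwMetric n).IsGeodesicFromTo (fun t => gramMap (γ t)) S₁ S₂ := by
  have hS₁ : (S₁ : CMat n).PosDef := h₁
  have hS₂ : (S₂ : CMat n).PosDef := h₂
  have hA := posDef_matSqrt hS₁
  have hB := posDef_matSqrt hS₂
  obtain ⟨T, hT, hTA⟩ := exists_posDef_mul_eq_mul_polarFactor hA hB
  rw [← hU] at hTA
  have hUU : U * Uᴴ = 1 := hU ▸ polarFactor_mul_conjTranspose (hB.isUnit.mul hA.isUnit)
  have hAA := matSqrt_mul_self hS₁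
  have hBB := matSqrt_mul_self hS₂
  set A := matSqrt (S₁ : CMat n)
  set B := matSqrt (S₂ : CMat n)
  have hTK : (T - 1).IsHermitian := hT.isHermitian.sub Matrix.isHermitian_one
  have hγ' : ∀ t, γ t = (1 + t • (T - 1)) * A := by
    intro t
    rw [hγ, ← hTA, add_mul, one_mul, smul_mul_assoc, sub_mul, one_mul]
    module
  have hγ0 : γ 0 = A := by simp [hγ]
  have hγ1 : γ 1 = B * U := by simp [hγ]
  -- As A is Hermitian with A² = Σ₁, the product (N A)(N A)* collapses to N Σ₁ N.
  have hcurve : (fun t => gramMap (γ t)) = congrCurve S₁ (HermMat.mk (T - 1) hTK) := by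
    funext t
    ext1
    have hN : (1 + t • (T - 1))ᴴ = 1 + t • (T - 1) := by
      rw [Matrix.conjTranspose_add, Matrix.conjTranspose_one, Matrix.conjTranspose_smul, hTK.eq,
        star_trivial]
    change γ t * (γ t)ᴴ = _
    rw [toMat_congrCurve, HermMat.toMat_mk, hγ', Matrix.conjTranspose_mul, hN, hA.isHermitian.eq,
      ← hAA]
    simp only [mul_assoc]
  refine ⟨fun t ht => ?_, ?_, ?_, ?_, ?_⟩
  · rw [hγ']
    exact (posDef_one_add_smul_sub_one hT ht).isUnit.mul hA.isUnit
  · have hd : HasDerivAt γ ((T - 1) * A) 0 := by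
      have h : γ = fun t => A + t • ((T - 1) * A) := by
        funext t
        rw [hγ', add_mul, one_mul, smul_mul_assoc]
      rw [h]
      have h' := ((hasDerivAt_id (0 : ℝ)).smul_const ((T - 1) * A)).const_add A
      rw [one_smul] at h'
      exact h'
    have hd' : deriv γ 0 = (T - 1) * A := hd.deriv
    rw [hd', hγ0]
    exact mul_mem_horizontalSpace hTK A
  · rw [hcurve]
    exact isGeodesicOn_congrCurve hS₁ _ (uniqueDiffOn_Icc zero_lt_one)
      fun t ht => posDef_one_add_smul_sub_one hT ht
  · ext1
    change γ 0 * (γ 0)ᴴ = _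
    rw [hγ0, hA.isHermitian.eq, hAA]
  · ext1
    change γ 1 * (γ 1)ᴴ = _
    rw [hγ1, Matrix.conjTranspose_mul, hB.isHermitian.eq, mul_assoc, ← mul_assoc U, hUU, one_mul,
      hBB]
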